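/- Let $F$ be a field of characteristic $0$ (for instance $F=\mathbb Q$), $V$ a finite dimensional vector space over $F$, and $k,n\ge 0$ integers. Put $X=\{x_1,\dots,x_k\}$. Identify $\mathrm{End}(V)^{\otimes n}$ with $\mathrm{End}(V^{\otimes n})$, and let $\sigma\in S_n$ act on $V^{\otimes n}$ by $\sigma(v_1\otimes\dots\otimes v_n)=v_{\sigma^{-1}(1)}\otimes\dots\otimes v_{\sigma^{-1}(n)}$. A polynomial map $H:\mathrm{End}(V)^k\to \mathrm{End}(V)^{\otimes n}$ is called $GL(V)$-equivariant if $H(gx_1g^{-1},\dots,gx_kg^{-1})=g^{\otimes n}H(x_1,\dots,x_k)(g^{\otimes n})^{-1}$ for all $g\in GL(V)$; such maps form an $F$-algebra $\mathcal T_X^n(V)$ under pointwise multiplication. (1) Every $GL(V)$-equivariant polynomial map $H:\mathrm{End}(V)^k\to\mathrm{End}(V)^{\otimes n}$ is an $F$-linear combination of maps of the form $$(x_1,\dots,x_k)\mapsto \prod_j \mathrm{tr}(N_j)\;\sigma^{-1}\circ (M_1\otimes\dots\otimes M_n),$$ where $\sigma\in S_n$ and $M_1,\dots,M_n$ and the finitely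 many $N_j$ are (possibly empty) noncommutative monomials in $x_1,\dots,x_k$, the empty monomial being $1$. (2) Let $F[\mathrm{tr}(M)]$ be the polynomial ring over $F$ in one variable $\mathrm{tr}(M)$ for each monomial $M$ (including $M=1$) in $X$ up to cyclic equivalence, let $T\langle X\rangle=F\langle X\rangle[\mathrm{tr}(M)]$ be the free algebra with trace, and let $T\langle X\rangle^{\otimes n}$ be its $n$-fold tensor power over $F[\mathrm{tr}(M)]$. Let $T\langle X\rangle^{\otimes n}\ltimes F[S_n]$ be $T\langle X\rangle^{\otimes n}\otimes_F F[S_n]$ with the product determined by the relations $\sigma\circ (M_1\otimes\dots\otimes M_n)=(M_{\sigma^{-1}(1)}\otimes\dots\otimes M_{\sigma^{-1}(n)})\circ\sigma$. Then the algebra homomorphism $$\pi_n: T\langle X\rangle^{\otimes n}\ltimes F[S_n]\to \mathcal T_X^n(V)$$ which evaluates the variables $x_i$ at endomorphisms of $V$, the symbols $\mathrm{tr}(M)$ at the traces of the evaluated monomials, and the elements of $S_n$ by their action on $V^{\otimes n}$, is surjective. -/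

import Mathlib

open scoped TensorProduct

noncomputable section

namespace TensorFFT

section Symbolic

variable (F : Type*) [Field F] (X : Type*) (n : ℕ)

/-- The central trace algebra `F[tr(M)]`: the polynomial algebra over `F` in one commuting variable
`tr(M)` for each (possibly empty) noncommutative monomial `M` in the variables `X` up to cyclic
equivalence.  `tr(1)`, the class of the empty monomial, is one of the variables. -/
abbrev TraceRing : Type _ := MvPolynomial (Cycle X) F

/-- The free algebra with trace `T⟨X⟩ = F⟨X⟩[tr(M)]`: the free associative algebra on `X` with
coefficients in the central polynomial algebra `F[tr(M)]`. -/
abbrev FreeTraceAlgebra : Type _ := FreeAlgebra (TraceRing F X) X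

/-- `T⟨X⟩^{⊗n}`, the tensor power of the algebra `T⟨X⟩` over its trace algebra `F[tr(M)]`
(for `n = 0` this is `F[tr(M)]` itself). -/
def TraceTensor : Type _ := ⨂[TraceRing F X] _ : Fin n, FreeTraceAlgebra F X

instance : Ring (TraceTensor F X n) :=
  inferInstanceAs (Ring (⨂[TraceRing F X] _ : Fin n, FreeTraceAlgebra F X))

instance : Algebra (TraceRing F X) (TraceTensor F X n) :=
  inferInstanceAs
    (Algebra (TraceRing F X) (⨂[TraceRing F X] _ : Fin n, FreeTraceAlgebra F X))

instance : Algebra F (TraceTensor F X n) :=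
  Algebra.compHom _ (algebraMap F (TraceRing F X))

instance : IsScalarTower F (TraceRing F X) (TraceTensor F X n) :=
  IsScalarTower.of_algebraMap_eq fun _ => rfl

variable {F X n}

/-- The decomposable tensor `a 0 ⊗ a 1 ⊗ … ⊗ a (n - 1)` of `T⟨X⟩^{⊗n}`. -/
def TraceTensor.tprod :
    MultilinearMap (TraceRing F X) (fun _ : Fin n => FreeTraceAlgebra F X) (TraceTensor F X n) :=
  PiTensorProduct.tprod (TraceRing F X)

theorem TraceTensor.tprod_mul (a b : Fin n → FreeTraceAlgebra F X) :
    TraceTensor.tprod a * TraceTensor.tprod b = TraceTensor.tprod (a * b) :=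
  PiTensorProduct.tprod_mul_tprod a b

theorem TraceTensor.induction {p : TraceTensor F X n → Prop} (t : TraceTensor F X n)
    (smul : ∀ (c : TraceRing F X) (a : Fin n → FreeTraceAlgebra F X), p (c • TraceTensor.tprod a))
    (add : ∀ s t, p s → p t → p (s + t)) : p t :=
  PiTensorProduct.induction_on t smul add

variable (F X n) in
/-- The linear map of `T⟨X⟩^{⊗n}` permuting the tensor factors,
`M_1 ⊗ … ⊗ M_n ↦ M_{σ⁻¹(1)} ⊗ … ⊗ M_{σ⁻¹(n)}`. -/
def TraceTensor.perm (σ : Equiv.Perm (Fin n)) :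
    TraceTensor F X n →ₗ[TraceRing F X] TraceTensor F X n :=
  (PiTensorProduct.reindex (TraceRing F X) (fun _ => FreeTraceAlgebra F X) σ).toLinearMap

theorem TraceTensor.perm_tprod (σ : Equiv.Perm (Fin n)) (a : Fin n → FreeTraceAlgebra F X) :
    TraceTensor.perm F X n σ (TraceTensor.tprod a) = TraceTensor.tprod fun i => a (σ⁻¹ i) :=
  PiTensorProduct.reindex_tprod (R := TraceRing F X) σ a

/-- `S_n` acts on `T⟨X⟩^{⊗n}` by algebra automorphisms, exchanging the tensor factors. -/
instance : MulSemiringAction (Equiv.Perm (Fin n)) (TraceTensor F X n) where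
  smul σ := TraceTensor.perm F X n σ
  one_smul t := by
    change TraceTensor.perm F X n 1 t = t
    induction t using TraceTensor.induction with
    | smul c a => rw [map_smul, TraceTensor.perm_tprod]; rfl
    | add s t hs ht => rw [map_add, hs, ht]
  mul_smul σ τ t := by
    change TraceTensor.perm F X n (σ * τ) t
      = TraceTensor.perm F X n σ (TraceTensor.perm F X n τ t)
    induction t using TraceTensor.induction with
    | smul c a => simp only [map_smul, TraceTensor.perm_tprod, mul_inv_rev, Equiv.Perm.mul_apply]
    | add s t hs ht => simp only [map_add, hs, ht]
  smul_zero σ := map_zero (TraceTensor.perm F X n σ)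
  smul_add σ := map_add (TraceTensor.perm F X n σ)
  smul_one σ := TraceTensor.perm_tprod σ 1
  smul_mul σ s t := by
    change TraceTensor.perm F X n σ (s * t)
      = TraceTensor.perm F X n σ s * TraceTensor.perm F X n σ t
    induction s using TraceTensor.induction with
    | add s₁ s₂ h₁ h₂ => simp only [add_mul, map_add, h₁, h₂]
    | smul c a =>
      induction t using TraceTensor.induction with
      | add t₁ t₂ h₁ h₂ => simp only [mul_add, map_add, h₁, h₂]
      | smul e b =>
        simp only [map_smul, smul_mul_assoc, mul_smul_comm, TraceTensor.tprod_mul,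
          TraceTensor.perm_tprod]
        rfl

theorem TraceTensor.smul_def (σ : Equiv.Perm (Fin n)) (t : TraceTensor F X n) :
    σ • t = TraceTensor.perm F X n σ t := rfl

instance : SMulCommClass (Equiv.Perm (Fin n)) F (TraceTensor F X n) where
  smul_comm σ c t := by
    rw [TraceTensor.smul_def, TraceTensor.smul_def, ← algebraMap_smul (TraceRing F X) c t,
      map_smul, algebraMap_smul]

variable (F X n) in
/-- The twisted group algebra `T⟨X⟩^{⊗n} ⋉ F[S_n]`: it is `T⟨X⟩^{⊗n} ⊗ F[S_n]` as a space, the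
element `M ∘ σ` being `SkewMonoidAlgebra.single σ M`, and its product is determined by the
commutation relations
`σ ∘ (M_1 ⊗ … ⊗ M_n) = (M_{σ⁻¹(1)} ⊗ … ⊗ M_{σ⁻¹(n)}) ∘ σ`. -/
abbrev TwistedAlgebra : Type _ := SkewMonoidAlgebra (TraceTensor F X n) (Equiv.Perm (Fin n))

end Symbolic

section Maps

variable (F : Type*) [Field F] (V : Type*) [AddCommGroup V] [Module F V] (X : Type*) (n : ℕ)

/-- The tensor power `V^{⊗n}`. -/
abbrev TPow : Type _ := ⨂[F] _ : Fin n, V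

/-- The algebra of polynomial functions on `End(V)^X`: the functions generated, as an algebra, by
the linear functions of one of the matrix variables, i.e. by the matrix entries of the variables. -/
def polyFun : Subalgebra F ((X → Module.End F V) → F) :=
  Algebra.adjoin F
    {f | ∃ (i : X) (φ : Module.Dual F (Module.End F V)), f = fun x => φ (x i)}

variable {F V X} in
/-- A map from `End(V)^X` to a finite dimensional space `W` is polynomial if its coordinates
are polynomial functions. -/
def IsPolyMap {W : Type*} [AddCommGroup W] [Module F W] (H : (X → Module.End F V) → W) : Prop :=
  ∀ φ : Module.Dual F W, (fun x => φ (H x)) ∈ polyFun F V X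

variable {F V X n} in
/-- Equivariance of a map `End(V)^X → End(V)^{⊗n} = End(V^{⊗n})` under conjugation by `GL(V)`:
`H(g x g⁻¹) = g^{⊗n} H(x) (g^{⊗n})⁻¹`. -/
def IsEquivariant (H : (X → Module.End F V) → Module.End F (TPow F V n)) : Prop :=
  ∀ (g : V ≃ₗ[F] V) (x : X → Module.End F V),
    H (fun i => g.conj (x i)) = (PiTensorProduct.congr fun _ : Fin n => g).conj (H x)

variable {F V X}

theorem IsPolyMap.mul [FiniteDimensional F V] {W : Type*} [AddCommGroup W] [Module F W]
    [FiniteDimensional F W] {H K : (X → Module.End F V) → Module.End F W}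
    (hH : IsPolyMap H) (hK : IsPolyMap K) : IsPolyMap (H * K) := by
  intro φ
  let b := Module.finBasis F (Module.End F W)
  have h : (fun x => φ ((H * K) x)) = ∑ i, ∑ j,
      φ (b i * b j) • ((fun x => b.coord i (H x)) * (fun x => b.coord j (K x))) := by
    funext x
    have h1 : H x * K x = ∑ i, ∑ j, (b.coord i (H x) * b.coord j (K x)) • (b i * b j) := by
      conv_lhs => rw [← b.sum_repr (H x), ← b.sum_repr (K x)]
      rw [Finset.sum_mul_sum]
      simp only [smul_mul_smul_comm, Module.Basis.coord_apply]
    simp only [Pi.mul_apply, h1, map_sum, map_smul, Finset.sum_apply, Pi.smul_apply, smul_eq_mul]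
    exact Finset.sum_congr rfl fun i _ => Finset.sum_congr rfl fun j _ => mul_comm _ _
  rw [h]
  exact Subalgebra.sum_mem _ fun i _ => Subalgebra.sum_mem _ fun j _ =>
    Subalgebra.smul_mem _ (Subalgebra.mul_mem _ (hH _) (hK _)) _

theorem IsPolyMap.add {W : Type*} [AddCommGroup W] [Module F W] {H K : (X → Module.End F V) → W}
    (hH : IsPolyMap H) (hK : IsPolyMap K) : IsPolyMap (H + K) := by
  intro φ
  have h : (fun x => φ ((H + K) x)) = (fun x => φ (H x)) + fun x => φ (K x) := by
    funext x; simp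
  rw [h]
  exact Subalgebra.add_mem _ (hH φ) (hK φ)

theorem IsPolyMap.const {W : Type*} [AddCommGroup W] [Module F W] (w : W) :
    IsPolyMap (fun _ : X → Module.End F V => w) := fun φ =>
  Subalgebra.algebraMap_mem (polyFun F V X) (φ w)

theorem IsPolyMap.smul {W : Type*} [AddCommGroup W] [Module F W]
    {f : (X → Module.End F V) → F} {H : (X → Module.End F V) → W}
    (hf : f ∈ polyFun F V X) (hH : IsPolyMap H) : IsPolyMap (fun x => f x • H x) := by
  intro φ
  simp only [map_smul, smul_eq_mul]
  exact Subalgebra.mul_mem _ hf (hH φ)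

variable (F V X) in
/-- The algebra `𝒯_X^n(V)` of polynomial `GL(V)`-equivariant maps `End(V)^X → End(V)^{⊗n}`, where
`End(V)^{⊗n} = End(V^{⊗n})`, under pointwise multiplication. -/
def equivariantMaps [FiniteDimensional F V] :
    Subalgebra F ((X → Module.End F V) → Module.End F (TPow F V n)) where
  carrier := {H | IsPolyMap H ∧ IsEquivariant H}
  mul_mem' {H K} hH hK := ⟨hH.1.mul hK.1, fun g x => by
    simp only [Pi.mul_apply, hH.2 g x, hK.2 g x, Module.End.mul_eq_comp, LinearEquiv.conj_comp]⟩
  add_mem' {H K} hH hK := ⟨hH.1.add hK.1, fun g x => by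
    simp only [Pi.add_apply, hH.2 g x, hK.2 g x, map_add]⟩
  algebraMap_mem' c := ⟨IsPolyMap.const (algebraMap F _ c), fun g x => by
    simp only [Pi.algebraMap_apply, Algebra.algebraMap_eq_smul_one, map_smul]
    congr 1
    exact (LinearEquiv.conj_id _).symm⟩

variable (F V) in
/-- The action of `S_n` on `V^{⊗n}`:
`σ (v_1 ⊗ … ⊗ v_n) = v_{σ⁻¹(1)} ⊗ … ⊗ v_{σ⁻¹(n)}`. -/
def permOp : Equiv.Perm (Fin n) →* Module.End F (TPow F V n) where
  toFun σ := (PiTensorProduct.reindex F (fun _ => V) σ).toLinearMap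
  map_one' := by
    refine PiTensorProduct.ext (MultilinearMap.ext fun v => ?_)
    exact PiTensorProduct.reindex_tprod (R := F) _ v
  map_mul' σ τ := by
    refine PiTensorProduct.ext (MultilinearMap.ext fun v => ?_)
    change PiTensorProduct.reindex F (fun _ => V) (σ * τ) (PiTensorProduct.tprod F v)
      = PiTensorProduct.reindex F (fun _ => V) σ
        (PiTensorProduct.reindex F (fun _ => V) τ (PiTensorProduct.tprod F v))
    simp only [PiTensorProduct.reindex_tprod]
    rfl

variable {n}

/-- The value at `x ∈ End(V)^X` of a noncommutative monomial in the variables `X`. -/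
def evalMonomial (M : FreeMonoid X) (x : X → Module.End F V) : Module.End F V :=
  FreeMonoid.lift x M

/-- The map `x ↦ ∏_j tr(N_j(x)) · σ⁻¹ ∘ (M_1(x) ⊗ … ⊗ M_n(x))` attached to monomials `M_i`, to a
finite list of monomials `N_j` and to a permutation `σ`. -/
def monomialMap (N : List (FreeMonoid X)) (M : Fin n → FreeMonoid X)
    (σ : Equiv.Perm (Fin n)) (x : X → Module.End F V) : Module.End F (TPow F V n) :=
  (N.map fun w => LinearMap.trace F V (evalMonomial w x)).prod •
    (permOp F V n σ⁻¹ * PiTensorProduct.map fun i => evalMonomial (M i) x)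

/-- The evaluation at `x` of the symbol `tr(M)`: the trace of the endomorphism `M(x)`. -/
def traceCycle (x : X → Module.End F V) : Cycle X → F :=
  Quotient.lift (fun l : List X => LinearMap.trace F V (l.map x).prod) (by
    rintro l _ ⟨k, rfl⟩
    induction k generalizing l with
    | zero => simp
    | succ k ih =>
      cases l with
      | nil => simp
      | cons a l =>
        rw [List.rotate_cons_succ]
        refine Eq.trans ?_ (ih (l ++ [a]))
        simp only [List.map_cons, List.prod_cons, List.map_append, List.map_nil, List.prod_append,
          List.prod_nil, mul_one]
        exact LinearMap.trace_mul_comm F _ _)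

/-- The evaluation at `x` of the trace algebra, `tr(M) ↦ trace of M(x)`. -/
def evalTrace (x : X → Module.End F V) : TraceRing F X →ₐ[F] F :=
  MvPolynomial.aeval (traceCycle x)

/-- The algebra `A`, made into an algebra over the trace algebra `F[tr(M)]` by letting
`tr(M)` act as the scalar `trace of M(x)`. -/
def AtPoint (_x : X → Module.End F V) (A : Type*) : Type _ := A

instance (x : X → Module.End F V) (A : Type*) [Ring A] : Ring (AtPoint x A) :=
  inferInstanceAs (Ring A)

instance (x : X → Module.End F V) (A : Type*) [Ring A] [Algebra F A] : Algebra F (AtPoint x A) :=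
  inferInstanceAs (Algebra F A)

instance (x : X → Module.End F V) (A : Type*) [Ring A] [Algebra F A] :
    Algebra (TraceRing F X) (AtPoint x A) :=
  Algebra.compHom (AtPoint x A) (evalTrace x : TraceRing F X →+* F)

theorem AtPoint.smul_def (x : X → Module.End F V) (A : Type*) [Ring A] [Algebra F A]
    (c : TraceRing F X) (a : AtPoint x A) : c • a = evalTrace x c • a := rfl

instance (x : X → Module.End F V) (A : Type*) [Ring A] [Algebra F A] :
    IsScalarTower F (TraceRing F X) (AtPoint x A) where
  smul_assoc c p a := by
    rw [AtPoint.smul_def, AtPoint.smul_def, map_smul, smul_assoc]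

/-- The identity map, from the type synonym `AtPoint x A` back to `A`. -/
def AtPoint.out (x : X → Module.End F V) (A : Type*) [Ring A] [Algebra F A] :
    AtPoint x A →ₐ[F] A :=
  AlgHom.id F A

theorem AtPoint.out_smul (x : X → Module.End F V) (A : Type*) [Ring A] [Algebra F A]
    (c : TraceRing F X) (a : AtPoint x A) :
    AtPoint.out x A (c • a) = evalTrace x c • AtPoint.out x A a := rfl

/-- A multilinear map of `F`-algebras, regarded as multilinear over the trace algebra. -/
def AtPoint.multilinear (x : X → Module.End F V) {A B : Type*} [Ring A] [Algebra F A] [Ring B]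
    [Algebra F B] (f : MultilinearMap F (fun _ : Fin n => A) B) :
    MultilinearMap (TraceRing F X) (fun _ : Fin n => AtPoint x A) (AtPoint x B) where
  toFun := f
  map_update_add' := f.map_update_add'
  map_update_smul' m i c a := f.map_update_smul' m i (evalTrace x c) a

/-- The homomorphism of algebras over the trace algebra that maps each variable to its value. -/
def evalFreeAt (x : X → Module.End F V) :
    FreeTraceAlgebra F X →ₐ[TraceRing F X] AtPoint x (Module.End F V) :=
  FreeAlgebra.lift (TraceRing F X) x

/-- The evaluation `a ↦ a(x)` of `T⟨X⟩` at `x ∈ End(V)^X`: each variable goes to its value and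
`tr(M)` to the scalar `trace of M(x)`. -/
def evalFree (x : X → Module.End F V) : FreeTraceAlgebra F X →ₐ[F] Module.End F V :=
  (AtPoint.out x _).comp ((evalFreeAt x).restrictScalars F)

theorem evalFree_ι (x : X → Module.End F V) (i : X) :
    evalFree x (FreeAlgebra.ι (TraceRing F X) i) = x i :=
  FreeAlgebra.lift_ι_apply (A := AtPoint x (Module.End F V)) (x : X → AtPoint x _) i

theorem evalFree_smul (x : X → Module.End F V) (c : TraceRing F X) (a : FreeTraceAlgebra F X) :
    evalFree x (c • a) = evalTrace x c • evalFree x a :=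
  map_smul (evalFreeAt x) c a

/-- The homomorphism of algebras over the trace algebra that maps
`a_1 ⊗ … ⊗ a_n` to `a_1(x) ⊗ … ⊗ a_n(x)`. -/
def evalTensorAt (x : X → Module.End F V) :
    TraceTensor F X n →ₐ[TraceRing F X] AtPoint x (Module.End F (TPow F V n)) :=
  PiTensorProduct.liftAlgHom (R := TraceRing F X)
    ((AtPoint.multilinear x
      (PiTensorProduct.mapMultilinear F (fun _ : Fin n => V) (fun _ : Fin n => V))).compLinearMap
        fun _ => (evalFreeAt x).toLinearMap)
    (by
      change PiTensorProduct.map (fun i => evalFree x ((1 : Fin n → FreeTraceAlgebra F X) i)) = 1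
      simp only [Pi.one_apply, map_one]
      exact PiTensorProduct.map_one)
    (fun a b => by
      change PiTensorProduct.map (fun i => evalFree x ((a * b) i)) = _
      simp only [Pi.mul_apply, map_mul]
      exact PiTensorProduct.map_mul _ _)

/-- The evaluation of `T⟨X⟩^{⊗n}` at `x`,
`a_1 ⊗ … ⊗ a_n ↦ a_1(x) ⊗ … ⊗ a_n(x) ∈ End(V)^{⊗n} = End(V^{⊗n})`. -/
def evalTensor (x : X → Module.End F V) : TraceTensor F X n →ₐ[F] Module.End F (TPow F V n) :=
  (AtPoint.out x _).comp ((evalTensorAt x).restrictScalars F)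

theorem evalTensor_tprod (x : X → Module.End F V) (a : Fin n → FreeTraceAlgebra F X) :
    evalTensor x (TraceTensor.tprod a) = PiTensorProduct.map fun i => evalFree x (a i) :=
  PiTensorProduct.lift.tprod (R := TraceRing F X)
    (φ := (AtPoint.multilinear x
      (PiTensorProduct.mapMultilinear F (fun _ : Fin n => V) (fun _ : Fin n => V))).compLinearMap
        fun _ => (evalFreeAt x).toLinearMap) a

theorem evalTensor_smul (x : X → Module.End F V) (c : TraceRing F X) (t : TraceTensor F X n) :
    evalTensor x (c • t) = evalTrace x c • evalTensor x t :=
  map_smul (evalTensorAt x) c t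

theorem permOp_tprod (σ : Equiv.Perm (Fin n)) (v : Fin n → V) :
    permOp F V n σ (PiTensorProduct.tprod F v) = PiTensorProduct.tprod F fun i => v (σ⁻¹ i) :=
  PiTensorProduct.reindex_tprod (R := F) σ v

theorem permOp_mul_map (σ : Equiv.Perm (Fin n)) (f : Fin n → Module.End F V) :
    permOp F V n σ * PiTensorProduct.map f
      = PiTensorProduct.map (fun i => f (σ⁻¹ i)) * permOp F V n σ := by
  refine PiTensorProduct.ext (MultilinearMap.ext fun v => ?_)
  simp only [LinearMap.compMultilinearMap_apply, Module.End.mul_apply, permOp_tprod,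
    PiTensorProduct.map_tprod]

/-- The evaluation of the twisted algebra `T⟨X⟩^{⊗n} ⋉ F[S_n]` at `x`: it is the evaluation at `x`
on `T⟨X⟩^{⊗n}`, and the action of permutations on `V^{⊗n}` on `S_n`. -/
def evalTwisted (x : X → Module.End F V) :
    TwistedAlgebra F X n →ₐ[F] Module.End F (TPow F V n) :=
  SkewMonoidAlgebra.liftNCAlgHom (evalTensor x) (permOp F V n) (by
    intro t σ
    induction t using TraceTensor.induction with
    | add s t hs ht => rw [smul_add, map_add, map_add, add_mul, mul_add, hs, ht]
    | smul c a =>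
      rw [TraceTensor.smul_def, map_smul, TraceTensor.perm_tprod, evalTensor_smul, evalTensor_smul,
        evalTensor_tprod, evalTensor_tprod, smul_mul_assoc, mul_smul_comm, permOp_mul_map])

theorem evalTwisted_single (x : X → Module.End F V) (σ : Equiv.Perm (Fin n))
    (t : TraceTensor F X n) :
    evalTwisted x (SkewMonoidAlgebra.single σ t) = evalTensor x t * permOp F V n σ :=
  SkewMonoidAlgebra.liftNC_single _ _ _ _

/-! The evaluations are polynomial equivariant maps of `x`. -/

theorem IsPolyMap.var (i : X) : IsPolyMap (fun x : X → Module.End F V => x i) := fun φ =>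
  Algebra.subset_adjoin ⟨i, φ, rfl⟩

theorem isPolyMap_prod [FiniteDimensional F V] (l : List X) :
    IsPolyMap (fun x : X → Module.End F V => (l.map x).prod) := by
  induction l with
  | nil => exact IsPolyMap.const _
  | cons a l ih =>
    simp only [List.map_cons, List.prod_cons]
    exact (IsPolyMap.var a).mul ih

theorem evalTrace_X (x : X → Module.End F V) (l : List X) :
    evalTrace x (MvPolynomial.X (l : Cycle X)) = LinearMap.trace F V (l.map x).prod :=
  MvPolynomial.aeval_X _ _

theorem evalTrace_mem [FiniteDimensional F V] (c : TraceRing F X) :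
    (fun x : X → Module.End F V => evalTrace x c) ∈ polyFun F V X := by
  induction c using MvPolynomial.induction_on with
  | C a =>
    simp only [evalTrace, MvPolynomial.aeval_C]
    exact Subalgebra.algebraMap_mem (polyFun F V X) a
  | add p q hp hq =>
    simp only [map_add]
    exact Subalgebra.add_mem _ hp hq
  | mul_X p w hp =>
    simp only [map_mul]
    refine Subalgebra.mul_mem _ hp ?_
    induction w using Quotient.inductionOn with
    | h l =>
      change (fun x => evalTrace x (MvPolynomial.X (l : Cycle X))) ∈ _
      simp only [evalTrace_X]
      exact isPolyMap_prod l (LinearMap.trace F V)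

theorem evalFree_algebraMap (x : X → Module.End F V) (c : TraceRing F X) :
    evalFree x (algebraMap _ _ c) = evalTrace x c • (1 : Module.End F V) := by
  rw [Algebra.algebraMap_eq_smul_one, evalFree_smul, map_one]

theorem isPolyMap_evalFree [FiniteDimensional F V] (a : FreeTraceAlgebra F X) :
    IsPolyMap (fun x : X → Module.End F V => evalFree x a) := by
  induction a using FreeAlgebra.induction with
  | grade0 c =>
    simp only [evalFree_algebraMap]
    exact (IsPolyMap.const (1 : Module.End F V)).smul (evalTrace_mem c)
  | grade1 i =>
    simp only [evalFree_ι]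
    exact IsPolyMap.var i
  | mul a b ha hb =>
    simp only [map_mul]
    exact ha.mul hb
  | add a b ha hb =>
    simp only [map_add]
    exact ha.add hb

theorem isPolyMap_map [FiniteDimensional F V] (H : Fin n → (X → Module.End F V) → Module.End F V)
    (hH : ∀ i, IsPolyMap (H i)) :
    IsPolyMap (fun x => (PiTensorProduct.map fun i => H i x : Module.End F (TPow F V n))) := by
  let b := Module.finBasis F (Module.End F V)
  intro φ
  have h : (fun x => φ (PiTensorProduct.map fun i => H i x : Module.End F (TPow F V n)))
      = ∑ r : Fin n → Fin (Module.finrank F (Module.End F V)),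
        φ (PiTensorProduct.map fun i => b (r i)) • ∏ i, fun x => b.coord (r i) (H i x) := by
    funext x
    have h1 : (PiTensorProduct.mapMultilinear F (fun _ : Fin n => V) (fun _ : Fin n => V))
        (fun i => H i x) = ∑ r : Fin n → Fin (Module.finrank F (Module.End F V)),
          (∏ i, b.coord (r i) (H i x)) •
            (PiTensorProduct.map fun i => b (r i) : Module.End F (TPow F V n)) := by
      have h2 : (fun i => H i x) = fun i => ∑ j, b.coord j (H i x) • b j := by
        funext i; exact (b.sum_repr (H i x)).symm
      rw [h2, MultilinearMap.map_sum]
      exact Finset.sum_congr rfl fun r _ => MultilinearMap.map_smul_univ _ _ _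
    change φ (PiTensorProduct.mapMultilinear F (fun _ : Fin n => V) (fun _ : Fin n => V)
      (fun i => H i x)) = _
    rw [h1]
    simp only [map_sum, map_smul, Finset.sum_apply, Pi.smul_apply, Finset.prod_apply, smul_eq_mul]
    exact Finset.sum_congr rfl fun r _ => mul_comm _ _
  rw [h]
  exact Subalgebra.sum_mem _ fun r _ => Subalgebra.smul_mem _
    (Subalgebra.prod_mem _ fun i _ => hH i (b.coord (r i))) _

theorem isPolyMap_evalTensor [FiniteDimensional F V] (t : TraceTensor F X n) :
    IsPolyMap (fun x : X → Module.End F V => evalTensor x t) := by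
  induction t using TraceTensor.induction with
  | smul c a =>
    simp only [evalTensor_smul, evalTensor_tprod]
    exact (isPolyMap_map _ fun i => isPolyMap_evalFree (a i)).smul (evalTrace_mem c)
  | add s t hs ht =>
    simp only [map_add]
    exact hs.add ht

theorem isPolyMap_evalTwisted [FiniteDimensional F V] (t : TwistedAlgebra F X n) :
    IsPolyMap (fun x : X → Module.End F V => evalTwisted x t) := by
  induction t using SkewMonoidAlgebra.induction_on with
  | zero => simp only [map_zero]; exact IsPolyMap.const 0
  | single σ t =>
    simp only [evalTwisted_single]
    exact (isPolyMap_evalTensor t).mul (IsPolyMap.const _)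
  | add s t hs ht =>
    simp only [map_add]
    exact hs.add ht

theorem conj_mul' {W : Type*} [AddCommGroup W] [Module F W] (e : W ≃ₗ[F] W)
    (f g : Module.End F W) : e.conj (f * g) = e.conj f * e.conj g :=
  e.conj_comp g f

theorem conj_prod (g : V ≃ₗ[F] V) (x : X → Module.End F V) (l : List X) :
    (l.map fun i => g.conj (x i)).prod = g.conj (l.map x).prod := by
  induction l with
  | nil => exact g.conj_id.symm
  | cons a l ih => simp only [List.map_cons, List.prod_cons, ih, conj_mul']

theorem evalTrace_conj (g : V ≃ₗ[F] V) (x : X → Module.End F V) (c : TraceRing F X) :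
    evalTrace (fun i => g.conj (x i)) c = evalTrace x c := by
  induction c using MvPolynomial.induction_on with
  | C a => simp only [evalTrace, MvPolynomial.aeval_C]
  | add p q hp hq => simp only [map_add, hp, hq]
  | mul_X p w hp =>
    rw [map_mul, map_mul, hp]
    congr 1
    induction w using Quotient.inductionOn with
    | h l =>
      change evalTrace _ (MvPolynomial.X (l : Cycle X))
        = evalTrace _ (MvPolynomial.X (l : Cycle X))
      rw [evalTrace_X, evalTrace_X, conj_prod, LinearMap.trace_conj']

theorem evalFree_conj (g : V ≃ₗ[F] V) (x : X → Module.End F V) (a : FreeTraceAlgebra F X) :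
    evalFree (fun i => g.conj (x i)) a = g.conj (evalFree x a) := by
  induction a using FreeAlgebra.induction with
  | grade0 c =>
    rw [evalFree_algebraMap, evalFree_algebraMap, map_smul, evalTrace_conj]
    congr 1
    exact g.conj_id.symm
  | grade1 i => rw [evalFree_ι, evalFree_ι]
  | mul a b ha hb => rw [map_mul, map_mul, ha, hb, conj_mul']
  | add a b ha hb => rw [map_add, map_add, ha, hb, map_add]

theorem evalTensor_conj (g : V ≃ₗ[F] V) (x : X → Module.End F V) (t : TraceTensor F X n) :
    evalTensor (fun i => g.conj (x i)) t
      = (PiTensorProduct.congr fun _ : Fin n => g).conj (evalTensor x t) := by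
  induction t using TraceTensor.induction with
  | smul c a =>
    rw [evalTensor_smul, evalTensor_smul, evalTensor_tprod, evalTensor_tprod, map_smul,
      evalTrace_conj]
    congr 1
    simp only [evalFree_conj]
    refine PiTensorProduct.ext (MultilinearMap.ext fun v => ?_)
    simp only [LinearMap.compMultilinearMap_apply, PiTensorProduct.map_tprod,
      LinearEquiv.conj_apply, LinearMap.comp_apply, LinearEquiv.coe_coe,
      PiTensorProduct.congr_symm_tprod, PiTensorProduct.congr_tprod]
  | add s t hs ht => rw [map_add, map_add, hs, ht, map_add]

theorem permOp_conj (g : V ≃ₗ[F] V) (σ : Equiv.Perm (Fin n)) :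
    (PiTensorProduct.congr fun _ : Fin n => g).conj (permOp F V n σ) = permOp F V n σ := by
  refine PiTensorProduct.ext (MultilinearMap.ext fun v => ?_)
  simp only [LinearMap.compMultilinearMap_apply, LinearEquiv.conj_apply, LinearMap.comp_apply,
    LinearEquiv.coe_coe, PiTensorProduct.congr_symm_tprod, permOp_tprod,
    PiTensorProduct.congr_tprod, LinearEquiv.apply_symm_apply]

theorem isEquivariant_evalTwisted (t : TwistedAlgebra F X n) :
    IsEquivariant (fun x : X → Module.End F V => evalTwisted x t) := by
  intro g x
  induction t using SkewMonoidAlgebra.induction_on with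
  | zero => simp only [map_zero]
  | single σ t =>
    simp only [evalTwisted_single, conj_mul', permOp_conj, evalTensor_conj]
  | add s t hs ht => simp only [map_add, hs, ht]

variable (F V X) (n) in
/-- The evaluation map `π_n : T⟨X⟩^{⊗n} ⋉ F[S_n] → 𝒯_X^n(V)`, sending a symbolic element to the map
`x ↦ its evaluation at x`. -/
def evaluation [FiniteDimensional F V] :
    TwistedAlgebra F X n →ₐ[F] equivariantMaps F V X n :=
  AlgHom.codRestrict
    (AlgHom.pi fun x : X → Module.End F V => evalTwisted x)
    (equivariantMaps F V X n)
    fun t => ⟨isPolyMap_evalTwisted t, isEquivariant_evalTwisted t⟩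

end Maps

end TensorFFT

end

noncomputable section

namespace TensorFFT

/-! ### Schur–Weyl duality for matrices indexed by words. -/

section SchurWeyl

variable {ι R : Type*}

/-! In a basis of `V`, an equivariant polynomial map becomes a matrix of polynomials in the entries
of generic matrices, with rows and columns indexed by words `Fin n → ι`. Its homogeneous components
are again equivariant, so the spanning statement can be proved by induction on the degree `m`, for
all `n` at once.

The derivative of `H` in the `i`-th matrix variable is a linear function of a direction in `End(V)`.
The trace form turns it into an equivariant map of degree `m - 1` with one more tensor factor
(`IsGenericEquivariant.matrixDeriv`). Euler's identity recovers `m • H` as the sum over `i` of the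
partial traces of these derivatives against `x_i` (`sum_contract_matrixDeriv`). Such a partial trace
sends monomial maps to monomial maps (`contract_mem`): it splits off a trace if the permutation
fixes the contracted factor, and otherwise joins two monomials. Characteristic zero permits division
by `m`.

In degree zero, equivariance says that a constant matrix commutes with every `g ⊗ … ⊗ g`, `g`
invertible. By Schur–Weyl duality (`mem_permSpan_of_commute_tensorPow`) it is then a combination of
permutations.

Surjectivity of `evaluation` follows because every monomial map is one of its values
(`exists_evaluation_eq_monomialMap`). -/

theorem exists_perm_comp_eq {m J : Type*} [Fintype m] (u v : m → J)
    (h : ∑ i, Finsupp.single (u i) 1 = (∑ i, Finsupp.single (v i) 1 : J →₀ ℕ)) :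
    ∃ σ : Equiv.Perm m, v ∘ σ = u := by
  classical
  have hcard : ∀ j, Fintype.card {i // u i = j} = Fintype.card {i // v i = j} := by
    intro j
    have := DFunLike.congr_fun h j
    simpa only [Finsupp.finsetSum_apply, Finsupp.single_apply, Fintype.card_subtype,
      Finset.card_filter] using this
  exact ⟨Equiv.ofFiberEquiv fun j => Fintype.equivOfCardEq (hcard j),
    funext fun i => Equiv.ofFiberEquiv_map _ i⟩

/-- Polarization in dual form: over an infinite field the powers `x ⊗ … ⊗ x` span the symmetric
tensors. The hypothesis makes a polynomial vanish identically. Since `B` depends only on how often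
each letter occurs in a word, the desired sum is the image of this polynomial under a linear
functional. -/
theorem sum_mul_eq_zero_of_forall_sum_mul_prod_eq_zero {F J : Type*} [Field F] [Infinite F]
    [Fintype J] {n : ℕ} (φ B : (Fin n → J) → F) (hB : ∀ (σ : Equiv.Perm (Fin n)) u, B (u ∘ σ) = B u)
    (h : ∀ x : J → F, ∑ u, φ u * ∏ i, x (u i) = 0) : ∑ u, φ u * B u = 0 := by
  classical
  let cnt : (Fin n → J) → (J →₀ ℕ) := fun u => ∑ i, Finsupp.single (u i) 1
  have hcnt : B.FactorsThrough cnt := by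
    intro u v huv
    obtain ⟨σ, rfl⟩ := exists_perm_comp_eq u v huv
    exact hB σ v
  have hp : ∑ u, MvPolynomial.monomial (cnt u) (φ u) = 0 := by
    refine MvPolynomial.funext fun x => ?_
    rw [map_zero, ← h x, map_sum]
    refine Finset.sum_congr rfl fun u _ => ?_
    rw [MvPolynomial.monomial_sum_index]
    simp [MvPolynomial.eval_monomial]
  -- The functional takes the monomial of the word `u` to `B u`; its value 0 on exponents that come
  -- from no word is irrelevant.
  have hL := congrArg ((MvPolynomial.basisMonomials J F).constr F (Function.extend cnt B 0)) hp
  rw [map_zero, map_sum] at hL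
  rw [← hL]
  refine Finset.sum_congr rfl fun u _ => ?_
  have : MvPolynomial.monomial (cnt u) (φ u) = φ u • MvPolynomial.basisMonomials J F (cnt u) := by
    simp [MvPolynomial.smul_monomial]
  rw [this, map_smul, Module.Basis.constr_basis, hcnt.extend_apply, smul_eq_mul]

/-- The matrix of `g ⊗ … ⊗ g` (`n` factors). -/
def tensorPow [CommSemiring R] (n : ℕ) (g : Matrix ι ι R) :
    Matrix (Fin n → ι) (Fin n → ι) R :=
  Matrix.of fun c d => ∏ i, g (c i) (d i)

variable {F : Type*} [Field F] [Fintype ι] {n : ℕ}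

/-- Density of the invertible matrices along the line `t - x`: an entry of the commutator is a
polynomial in `t` that vanishes wherever the characteristic polynomial of `x` does not, hence it is
zero. -/
theorem commute_tensorPow_of_forall_invertible [Infinite F] [DecidableEq ι]
    {A : Matrix (Fin n → ι) (Fin n → ι) F}
    (hA : ∀ g h : Matrix ι ι F, g * h = 1 → h * g = 1 → A * tensorPow n g = tensorPow n g * A)
    (x : Matrix ι ι F) : A * tensorPow n x = tensorPow n x * A := by
  -- The line `t - x` passes through `-x` at `t = 0`.
  suffices H : ∀ x : Matrix ι ι F, A * tensorPow n (-x) = tensorPow n (-x) * A by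
    simpa only [neg_neg] using H (-x)
  clear x
  intro x
  ext c d
  let y : Matrix ι ι (Polynomial F) := Matrix.charmatrix x
  let Y := tensorPow n y
  let p : Polynomial F := ((A.map Polynomial.C) * Y - Y * A.map Polynomial.C) c d
  have hy : ∀ t, y.map (Polynomial.eval t) = Matrix.scalar ι t - x := fun t => by
    ext i j; simp [y, Matrix.charmatrix_apply, Matrix.diagonal_apply, apply_ite]
  have hev : ∀ t, p.eval t = (A * tensorPow n (Matrix.scalar ι t - x)
      - tensorPow n (Matrix.scalar ι t - x) * A) c d := by
    intro t
    simp only [← hy]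
    simp [p, Y, tensorPow, Matrix.mul_apply, Polynomial.eval_finsetSum, Polynomial.eval_prod]
  have hp : p * x.charpoly = 0 := by
    refine Polynomial.funext fun t => ?_
    rw [Polynomial.eval_mul, hev, Matrix.eval_charpoly, Polynomial.eval_zero]
    by_cases hdet : (Matrix.scalar ι t - x).det = 0
    · rw [hdet, mul_zero]
    · have hu : IsUnit (Matrix.scalar ι t - x).det := isUnit_iff_ne_zero.2 hdet
      rw [hA _ _ (Matrix.mul_nonsing_inv _ hu) (Matrix.nonsing_inv_mul _ hu), sub_self,
        Matrix.zero_apply, zero_mul]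
  have h0 := hev 0
  rw [(mul_eq_zero.1 hp).resolve_right x.charpoly_monic.ne_zero, Polynomial.eval_zero, map_zero,
    zero_sub, Matrix.sub_apply, eq_comm, sub_eq_zero] at h0
  exact h0

theorem commute_of_forall_commute_tensorPow [Infinite F]
    {A : Matrix (Fin n → ι) (Fin n → ι) F}
    (hA : ∀ x : Matrix ι ι F, A * tensorPow n x = tensorPow n x * A)
    {B : Matrix (Fin n → ι) (Fin n → ι) F}
    (hB : ∀ (σ : Equiv.Perm (Fin n)) c d, B (c ∘ σ) (d ∘ σ) = B c d) : A * B = B * A := by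
  classical
  ext c d
  let e : (Fin n → ι × ι) ≃ (Fin n → ι) × (Fin n → ι) := Equiv.arrowProdEquivProdArrow _ _ _
  -- Coefficients of the functional `Y ↦ (A * Y - Y * A) c d`; a pair of words is read as one word
  -- in the alphabet `ι × ι`, to which polarization applies.
  let φ : (Fin n → ι) × (Fin n → ι) → F := fun q =>
    (if q.2 = d then A c q.1 else 0) - (if q.1 = c then A q.2 d else 0)
  have key : ∀ Y : Matrix (Fin n → ι) (Fin n → ι) F,
      ∑ u, φ (e u) * Y (e u).1 (e u).2 = (A * Y - Y * A) c d := by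
    intro Y
    rw [e.sum_comp fun q => φ q * Y q.1 q.2, Fintype.sum_prod_type]
    simp only [φ, sub_mul, ite_mul, zero_mul, Finset.sum_sub_distrib, Matrix.sub_apply,
      Matrix.mul_apply, Finset.sum_ite_eq', Finset.mem_univ, if_true]
    congr 1
    rw [Finset.sum_comm]
    simp only [Finset.sum_ite_eq', Finset.mem_univ, if_true, mul_comm]
  have := sum_mul_eq_zero_of_forall_sum_mul_prod_eq_zero (fun u => φ (e u))
    (fun u => B (e u).1 (e u).2) (fun σ u => hB σ (e u).1 (e u).2) (fun x => by
      have h := key (tensorPow n (Matrix.of fun a b => x (a, b)))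
      rw [hA, sub_self, Matrix.zero_apply] at h
      exact h)
  rwa [key, Matrix.sub_apply, sub_eq_zero] at this

variable (ι F n) in
/-- The span of the operators permuting the tensor factors, as matrices. -/
def permSpan [DecidableEq ι] : Submodule F (Matrix (Fin n → ι) (Fin n → ι) F) :=
  Submodule.span F (Set.range fun σ : Equiv.Perm (Fin n) =>
    (1 : Matrix (Fin n → ι) (Fin n → ι) F).submatrix (· ∘ σ) id)

/-- Double centralizer by Maschke averaging. Averaging a projection onto `permSpan` gives a map `p`
with values in `permSpan` that commutes with left multiplication by permutations and fixes `1`. The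
columns of `p` are invariant operators, with which `A` commutes, so `p A = A * p 1 = A`. -/
theorem mem_permSpan_of_forall_commute [CharZero F] [DecidableEq ι]
    {A : Matrix (Fin n → ι) (Fin n → ι) F}
    (hA : ∀ B : Matrix (Fin n → ι) (Fin n → ι) F,
      (∀ (σ : Equiv.Perm (Fin n)) c d, B (c ∘ σ) (d ∘ σ) = B c d) → A * B = B * A) :
    A ∈ permSpan ι F n := by
  let S : Equiv.Perm (Fin n) → Matrix (Fin n → ι) (Fin n → ι) F →ₗ[F]
      Matrix (Fin n → ι) (Fin n → ι) F := fun σ =>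
    { toFun := fun X => X.submatrix (· ∘ σ) id
      map_add' := fun _ _ => rfl
      map_smul' := fun _ _ => rfl }
  have hS : ∀ σ τ X, S σ (S τ X) = S (σ * τ) X := fun σ τ X => rfl
  have hS1 : ∀ X, S 1 X = X := fun X => rfl
  have hSN : ∀ σ X, X ∈ permSpan ι F n → S σ X ∈ permSpan ι F n := by
    intro σ X hX
    induction hX using Submodule.span_induction with
    | mem X hX =>
      obtain ⟨τ, rfl⟩ := hX
      exact Submodule.subset_span ⟨σ * τ, rfl⟩
    | zero => rw [map_zero]; exact zero_mem _
    | add X Y _ _ h₁ h₂ => rw [map_add]; exact add_mem h₁ h₂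
    | smul c X _ h => rw [map_smul]; exact Submodule.smul_mem _ _ h
  obtain ⟨q, hq⟩ := (permSpan ι F n).subtype.exists_leftInverse_of_injective
    (permSpan ι F n).ker_subtype
  have hq' : ∀ X (hX : X ∈ permSpan ι F n), (q X : Matrix (Fin n → ι) (Fin n → ι) F) = X :=
    fun X hX => congrArg Subtype.val (LinearMap.congr_fun hq ⟨X, hX⟩)
  let p : Matrix (Fin n → ι) (Fin n → ι) F →ₗ[F] Matrix (Fin n → ι) (Fin n → ι) F :=
    (Fintype.card (Equiv.Perm (Fin n)) : F)⁻¹ •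
      ∑ σ, S σ⁻¹ ∘ₗ (permSpan ι F n).subtype ∘ₗ q ∘ₗ S σ
  have hp : ∀ X, p X = (Fintype.card (Equiv.Perm (Fin n)) : F)⁻¹ • ∑ σ, S σ⁻¹ (q (S σ X)) := by
    intro X
    simp [p]
  have hpN : ∀ X, p X ∈ permSpan ι F n := by
    intro X
    rw [hp]
    exact Submodule.smul_mem _ _ (Submodule.sum_mem _ fun σ _ => hSN _ _ (q _).2)
  have hp1 : p 1 = 1 := by
    have h : ∀ σ, S σ⁻¹ (q (S σ 1)) = 1 := by
      intro σ
      rw [hq' (S σ 1) (Submodule.subset_span ⟨σ, rfl⟩), hS, inv_mul_cancel, hS1]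
    rw [hp, Finset.sum_congr rfl fun σ _ => h σ, Finset.sum_const, Finset.card_univ,
      ← Nat.cast_smul_eq_nsmul F, smul_smul,
      inv_mul_cancel₀ (Nat.cast_ne_zero.2 Fintype.card_ne_zero), one_smul]
  have hpS : ∀ τ X, p (S τ X) = S τ (p X) := by
    intro τ X
    rw [hp, hp, map_smul, map_sum, ← Equiv.sum_comp (Equiv.mulRight τ)
      fun σ => S τ (S σ⁻¹ (q (S σ X)))]
    congr 1
    refine Finset.sum_congr rfl fun σ _ => ?_
    simp only [Equiv.coe_mulRight, hS, mul_inv_rev, mul_inv_cancel_left]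
  have hSsingle : ∀ (σ : Equiv.Perm (Fin n)) e f,
      S σ (Matrix.single (e ∘ σ) f 1) = Matrix.single e f 1 := by
    intro σ e f
    ext c d
    have : e ∘ σ = c ∘ σ ↔ e = c := σ.surjective.injective_comp_right.eq_iff
    change Matrix.single (e ∘ σ) f (1 : F) (c ∘ σ) d = _
    simp only [Matrix.single_apply, this]
  -- The block of `p` from column `f` to column `j`: put a vector in column `f`, apply `p`, read
  -- column `j`.
  let B : (Fin n → ι) → (Fin n → ι) → Matrix (Fin n → ι) (Fin n → ι) F := fun f j =>
    Matrix.of fun c e => p (Matrix.single e f 1) c j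
  have hB : ∀ f j, A * B f j = B f j * A := by
    intro f j
    refine hA _ fun σ c d => ?_
    simp only [B, Matrix.of_apply]
    rw [← hSsingle σ d f, hpS]
    rfl
  have hpA : p A = A := by
    have h : A = ∑ e, ∑ f, A e f • Matrix.single e f (1 : F) := by
      conv_lhs => rw [Matrix.matrix_eq_sum_single A]
      simp
    ext c j
    calc p A c j = ∑ e, ∑ f, A e f * p (Matrix.single e f 1) c j := by
          conv_lhs => rw [h]
          simp only [map_sum, map_smul, Matrix.sum_apply, Matrix.smul_apply, smul_eq_mul]
      _ = ∑ f, (B f j * A) c f := by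
          rw [Finset.sum_comm]
          simp [Matrix.mul_apply, B, mul_comm]
      _ = ∑ f, (A * B f j) c f := by simp only [hB]
      _ = ∑ e, A c e * p 1 e j := by
          simp only [Matrix.mul_apply, B, Matrix.of_apply]
          rw [Finset.sum_comm]
          simp only [← Finset.mul_sum, ← Matrix.sum_apply, ← map_sum, Matrix.sum_single_one]
      _ = A c j := by simp [hp1, Matrix.one_apply]
  exact hpA ▸ hpN A

theorem mem_permSpan_of_commute_tensorPow [CharZero F] [DecidableEq ι]
    {A : Matrix (Fin n → ι) (Fin n → ι) F}
    (hA : ∀ g h : Matrix ι ι F, g * h = 1 → h * g = 1 → A * tensorPow n g = tensorPow n g * A) :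
    A ∈ permSpan ι F n :=
  mem_permSpan_of_forall_commute fun _ hB =>
    commute_of_forall_commute_tensorPow (commute_tensorPow_of_forall_invertible hA) hB

end SchurWeyl

/-! ### Equivariant matrices of polynomials in generic matrices. -/

section Generic

open MvPolynomial

variable {F : Type*} [Field F] {κ ι : Type*} {n : ℕ}

theorem pderiv_aeval {S T : Type*} [Fintype S] (f : S → MvPolynomial T F) (v : T)
    (p : MvPolynomial S F) :
    pderiv v (aeval f p) = ∑ w, aeval f (pderiv w p) * pderiv v (f w) := by
  classical
  induction p using MvPolynomial.induction_on with
  | C a => simp [← algebraMap_eq]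
  | add p q hp hq => simp only [map_add, hp, hq, add_mul, Finset.sum_add_distrib]
  | mul_X p i hp =>
    simp only [map_mul, aeval_X, Derivation.leibniz, smul_eq_mul, hp, map_add, add_mul,
      Finset.sum_add_distrib, pderiv_X]
    congr 1
    · simp [Pi.single_apply, apply_ite]
    · rw [Finset.mul_sum]
      exact Finset.sum_congr rfl fun w _ => by ring

variable (F ι) in
/-- The matrix whose entries are the variables with label `i`. -/
def genericMatrix (i : κ) : Matrix ι ι (MvPolynomial (κ × ι × ι) F) :=
  Matrix.of fun a b => X (i, a, b)

variable [Fintype ι] [DecidableEq ι]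

variable (F ι) in
/-- The noncommutative monomial `M` in the generic matrices. -/
def genericMonomial : FreeMonoid κ →* Matrix ι ι (MvPolynomial (κ × ι × ι) F) :=
  FreeMonoid.lift (genericMatrix F ι)

@[simp]
theorem genericMonomial_of (i : κ) : genericMonomial F ι (FreeMonoid.of i) = genericMatrix F ι i :=
  FreeMonoid.lift_eval_of _ _

variable (F ι) in
/-- The matrix of `∏_j tr(N_j) · σ ∘ (M_1 ⊗ … ⊗ M_n)` with generic matrices as variables. -/
def tensorMonomial (N : List (FreeMonoid κ)) (M : Fin n → FreeMonoid κ)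
    (σ : Equiv.Perm (Fin n)) :
    Matrix (Fin n → ι) (Fin n → ι) (MvPolynomial (κ × ι × ι) F) :=
  Matrix.of fun c d => (N.map fun w => (genericMonomial F ι w).trace).prod *
    ∏ i, genericMonomial F ι (M i) (c (σ i)) (d i)

variable (F κ ι n) in
/-- The span of the matrices `tensorMonomial N M σ`. -/
def tensorMonomialSpan :
    Submodule F (Matrix (Fin n → ι) (Fin n → ι) (MvPolynomial (κ × ι × ι) F)) :=
  Submodule.span F {K | ∃ N M σ, K = tensorMonomial F ι N M σ}

/-- Partial trace over the first tensor factor after multiplication of this factor by the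
`i`-th generic matrix. -/
def contract (i : κ) :
    Matrix (Fin (n + 1) → ι) (Fin (n + 1) → ι) (MvPolynomial (κ × ι × ι) F) →ₗ[F]
      Matrix (Fin n → ι) (Fin n → ι) (MvPolynomial (κ × ι × ι) F) where
  toFun H := Matrix.of fun c d =>
    ∑ b, ∑ a, H (Fin.cons b c : Fin (n + 1) → ι) (Fin.cons a d : Fin (n + 1) → ι) * X (i, a, b)
  map_add' H K := by
    ext1 c d
    simp [add_mul, Finset.sum_add_distrib]
  map_smul' r H := by
    ext1 c d
    simp [Finset.smul_sum]

omit [DecidableEq ι] in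
theorem contract_apply (i : κ)
    (H : Matrix (Fin (n + 1) → ι) (Fin (n + 1) → ι) (MvPolynomial (κ × ι × ι) F)) (c d) :
    contract i H c d = ∑ b, ∑ a,
      H (Fin.cons b c : Fin (n + 1) → ι) (Fin.cons a d : Fin (n + 1) → ι) * X (i, a, b) := rfl

/-- Here the permutation fixes the contracted factor, so the sum closes up to the new trace of `M 0
* x_i`. -/
theorem contract_tensorMonomial_zero (i : κ) (N : List (FreeMonoid κ))
    (M : Fin (n + 1) → FreeMonoid κ) (e : Equiv.Perm (Fin n)) :
    contract i (tensorMonomial F ι N M (Equiv.Perm.decomposeFin.symm (0, e)))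
      = tensorMonomial F ι ((M 0 * FreeMonoid.of i) :: N) (fun j => M j.succ) e := by
  ext1 c d
  simp only [contract_apply, tensorMonomial, Matrix.of_apply, Fin.prod_univ_succ,
    Equiv.Perm.decomposeFin_symm_apply_zero, Equiv.Perm.decomposeFin_symm_apply_succ,
    Equiv.swap_self, Equiv.refl_apply, Fin.cons_zero, Fin.cons_succ, List.map_cons, List.prod_cons,
    map_mul, genericMonomial_of, Matrix.trace, Matrix.diag_apply, Matrix.mul_apply, genericMatrix,
    Finset.sum_mul]
  refine Finset.sum_congr rfl fun b _ => Finset.sum_congr rfl fun a _ => ?_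
  ring

/-- The permutation sends `0` to `j.succ` and `(e.symm j).succ` to `0`. Summing over the two
contracted indices therefore multiplies `M 0`, `x_i` and the monomial in position `e.symm j`, and
leaves the permutation `e`. -/
theorem contract_tensorMonomial_succ (i : κ) (N : List (FreeMonoid κ))
    (M : Fin (n + 1) → FreeMonoid κ) (e : Equiv.Perm (Fin n)) (j : Fin n) :
    contract i (tensorMonomial F ι N M (Equiv.Perm.decomposeFin.symm (j.succ, e)))
      = tensorMonomial F ι N (Function.update (fun l => M l.succ) (e.symm j)
        (M 0 * FreeMonoid.of i * M (e.symm j).succ)) e := by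
  ext1 c d
  have hsw : ∀ l ∈ Finset.univ.erase (e.symm j),
      Equiv.swap 0 j.succ (e l).succ = (e l).succ := by
    intro l hl
    refine Equiv.swap_apply_of_ne_of_ne (Fin.succ_ne_zero _) fun h => ?_
    exact Finset.ne_of_mem_erase hl (by rw [← Fin.succ_injective _ h, e.symm_apply_apply])
  simp only [contract_apply, tensorMonomial, Matrix.of_apply, Fin.prod_univ_succ,
    Equiv.Perm.decomposeFin_symm_apply_zero, Equiv.Perm.decomposeFin_symm_apply_succ,
    Fin.cons_zero, Fin.cons_succ]
  rw [← Finset.mul_prod_erase _ _ (Finset.mem_univ (e.symm j)), Function.update_self,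
    Finset.prod_congr rfl fun l hl => by rw [Function.update_of_ne (Finset.ne_of_mem_erase hl)]]
  have hprod : ∀ b, ∏ l, genericMonomial F ι (M l.succ)
      ((Fin.cons b c : Fin (n + 1) → ι) (Equiv.swap 0 j.succ (e l).succ)) (d l)
      = genericMonomial F ι (M (e.symm j).succ) b (d (e.symm j)) *
        ∏ l ∈ Finset.univ.erase (e.symm j), genericMonomial F ι (M l.succ) (c (e l)) (d l) := by
    intro b
    rw [← Finset.mul_prod_erase _ _ (Finset.mem_univ (e.symm j)),
      Finset.prod_congr rfl fun l hl => by rw [hsw l hl, Fin.cons_succ]]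
    simp
  simp only [hprod, map_mul, genericMonomial_of, Matrix.mul_apply, Equiv.apply_symm_apply,
    genericMatrix, Matrix.of_apply, Finset.sum_mul, Finset.mul_sum]
  refine Finset.sum_congr rfl fun b _ => Finset.sum_congr rfl fun a _ => ?_
  ring

theorem contract_mem (i : κ)
    {H : Matrix (Fin (n + 1) → ι) (Fin (n + 1) → ι) (MvPolynomial (κ × ι × ι) F)}
    (hH : H ∈ tensorMonomialSpan F κ ι (n + 1)) : contract i H ∈ tensorMonomialSpan F κ ι n := by
  refine (Submodule.map_span_le (contract i) _ _).2 ?_ (Submodule.mem_map_of_mem hH)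
  rintro _ ⟨N, M, σ, rfl⟩
  obtain ⟨⟨p, e⟩, rfl⟩ := Equiv.Perm.decomposeFin.symm.surjective σ
  refine Fin.cases ?_ (fun j => ?_) p
  · rw [contract_tensorMonomial_zero]
    exact Submodule.subset_span ⟨_, _, _, rfl⟩
  · rw [contract_tensorMonomial_succ]
    exact Submodule.subset_span ⟨_, _, _, rfl⟩

/-- The substitution `x ↦ g x h` in the generic matrices. -/
def conjSubst (g h : Matrix ι ι F) :
    MvPolynomial (κ × ι × ι) F →ₐ[F] MvPolynomial (κ × ι × ι) F :=
  aeval fun v => ∑ a, ∑ b, C (g v.2.1 a * h b v.2.2) * X (v.1, a, b)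

/-- Equivariance under conjugation of a matrix of polynomials. -/
def IsGenericEquivariant (H : Matrix (Fin n → ι) (Fin n → ι) (MvPolynomial (κ × ι × ι) F)) :
    Prop :=
  ∀ g h : Matrix ι ι F, g * h = 1 → h * g = 1 →
    H.map (conjSubst g h) * (tensorPow n g).map C = (tensorPow n g).map C * H

theorem IsGenericEquivariant.apply
    {H : Matrix (Fin n → ι) (Fin n → ι) (MvPolynomial (κ × ι × ι) F)}
    (hH : IsGenericEquivariant H) {g h : Matrix ι ι F} (hgh : g * h = 1) (hhg : h * g = 1) (c d) :
    ∑ e, conjSubst g h (H c e) * C (tensorPow n g e d) = ∑ e, C (tensorPow n g c e) * H e d := by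
  simpa only [Matrix.mul_apply, Matrix.map_apply] using congrFun (congrFun (hH g h hgh hhg) c) d

/-- The derivative with respect to the `i`-th variable, as a matrix with one more tensor factor. -/
def matrixDeriv (i : κ) (H : Matrix (Fin n → ι) (Fin n → ι) (MvPolynomial (κ × ι × ι) F)) :
    Matrix (Fin (n + 1) → ι) (Fin (n + 1) → ι) (MvPolynomial (κ × ι × ι) F) :=
  Matrix.of fun c d => pderiv (i, d 0, c 0) (H (Fin.tail c) (Fin.tail d))

variable [Fintype κ]

theorem pderiv_conjSubst (g h : Matrix ι ι F) (i : κ) (p q : ι)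
    (f : MvPolynomial (κ × ι × ι) F) :
    pderiv (i, p, q) (conjSubst g h f)
      = ∑ a, ∑ b, conjSubst g h (pderiv (i, a, b) f) * C (g a p * h q b) := by
  classical
  have h1 : ∀ w : κ × ι × ι, pderiv (i, p, q)
      (∑ a, ∑ b, C (g w.2.1 a * h b w.2.2) * X (w.1, a, b) : MvPolynomial (κ × ι × ι) F)
      = if w.1 = i then C (g w.2.1 p * h q w.2.2) else 0 := by
    intro w
    by_cases hw : w.1 = i
    · simp [pderiv_X, Pi.single_apply, hw, ite_and]
    · simp [pderiv_X, hw]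
  rw [conjSubst, pderiv_aeval]
  simp only [h1, Fintype.sum_prod_type, mul_ite, mul_zero]
  rw [Finset.sum_eq_single i (fun j _ hj => by simp [hj]) (by simp)]
  simp

omit [DecidableEq ι] in
-- Euler's identity. The transposed index pair `(d 0, c 0)` in `matrixDeriv` is what pairs each
-- partial derivative with its own variable in the partial trace.
theorem sum_contract_matrixDeriv (H : Matrix (Fin n → ι) (Fin n → ι) (MvPolynomial (κ × ι × ι) F))
    {m : ℕ} (hH : ∀ c d, (H c d).IsHomogeneous m) :
    ∑ i, contract i (matrixDeriv i H) = m • H := by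
  ext1 c d
  simp only [Matrix.sum_apply, contract_apply, matrixDeriv, Matrix.of_apply, Fin.cons_zero,
    Fin.tail_cons, Matrix.smul_apply]
  rw [← (hH c d).sum_X_mul_pderiv]
  simp only [Fintype.sum_prod_type]
  refine Finset.sum_congr rfl fun i _ => ?_
  rw [Finset.sum_comm]
  exact Finset.sum_congr rfl fun a _ => Finset.sum_congr rfl fun b _ => mul_comm _ _

/-- Differentiating the equivariance identity brings in, by the chain rule, a factor `g` and a
factor `h`. Multiplication by `g` in the new tensor factor cancels `h`, since `g * h = 1`. -/
theorem IsGenericEquivariant.matrixDeriv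
    {H : Matrix (Fin n → ι) (Fin n → ι) (MvPolynomial (κ × ι × ι) F)}
    (hH : IsGenericEquivariant H) (i : κ) : IsGenericEquivariant (matrixDeriv i H) := by
  intro g h hgh hhg
  ext1 c d
  have key : ∀ q, ∑ e, C (tensorPow n g e (Fin.tail d)) *
      ∑ a, ∑ b, conjSubst g h (pderiv (i, a, b) (H (Fin.tail c) e)) * C (g a (d 0) * h q b)
      = ∑ e, C (tensorPow n g (Fin.tail c) e) * pderiv (i, d 0, q) (H e (Fin.tail d)) := by
    intro q
    have := congrArg (pderiv (i, d 0, q)) (hH.apply hgh hhg (Fin.tail c) (Fin.tail d))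
    simpa only [map_sum, Derivation.leibniz, smul_eq_mul, pderiv_C, mul_zero, add_zero, zero_add,
      pderiv_conjSubst] using this
  have hδ : ∀ b, ∑ q, C (g (c 0) q) * C (h q b)
      = (if c 0 = b then 1 else 0 : MvPolynomial (κ × ι × ι) F) := by
    intro b
    have := congrArg (C (σ := κ × ι × ι)) (congrFun (congrFun hgh (c 0)) b)
    simpa [Matrix.mul_apply, Matrix.one_apply, apply_ite] using this
  have hpow : ∀ c d : Fin (n + 1) → ι,
      tensorPow (n + 1) g c d = g (c 0) (d 0) * tensorPow n g (Fin.tail c) (Fin.tail d) :=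
    fun c d => Fin.prod_univ_succ _
  simp only [Matrix.mul_apply, Matrix.map_apply, TensorFFT.matrixDeriv, Matrix.of_apply, hpow]
  rw [← (Fin.consEquiv fun _ => ι).sum_comp, ← (Fin.consEquiv fun _ => ι).sum_comp,
    Fintype.sum_prod_type, Fintype.sum_prod_type]
  have htail : ∀ a e, Fin.tail (Fin.consEquiv (fun _ : Fin (n + 1) => ι) (a, e)) = e :=
    fun _ _ => rfl
  simp only [Fin.consEquiv_apply, Fin.cons_zero, htail, map_mul]
  calc _ = ∑ a, ∑ e, ∑ b, ∑ q, C (g (c 0) q) * C (h q b) *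
          (conjSubst g h (pderiv (i, a, b) (H (Fin.tail c) e)) *
            (C (g a (d 0)) * C (tensorPow n g e (Fin.tail d)))) := by
        simp only [← Finset.sum_mul, hδ, ite_mul, one_mul, zero_mul, Finset.sum_ite_eq,
          Finset.mem_univ, if_true]
    _ = ∑ q, C (g (c 0) q) * ∑ e, C (tensorPow n g (Fin.tail c) e) *
          pderiv (i, d 0, q) (H e (Fin.tail d)) := by
        simp only [← key, Finset.mul_sum]
        rw [Finset.sum_comm]
        conv_rhs => rw [Finset.sum_comm]
        refine Finset.sum_congr rfl fun e _ => ?_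
        conv_rhs => rw [Finset.sum_comm]
        refine Finset.sum_congr rfl fun a _ => ?_
        rw [Finset.sum_comm]
        refine Finset.sum_congr rfl fun q _ => Finset.sum_congr rfl fun b _ => ?_
        rw [map_mul]
        ring
    _ = _ := by
        simp only [Finset.mul_sum, mul_assoc]

omit [DecidableEq ι] [Fintype κ] in
-- The substitution is linear in the variables, so it preserves degrees.
theorem homogeneousComponent_conjSubst (g h : Matrix ι ι F) (m : ℕ)
    (p : MvPolynomial (κ × ι × ι) F) :
    homogeneousComponent m (conjSubst g h p) = conjSubst g h (homogeneousComponent m p) := by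
  have hhom : ∀ j, (conjSubst g h (homogeneousComponent j p)).IsHomogeneous j := by
    intro j
    have := (homogeneousComponent_isHomogeneous j p).aeval
      (fun v : κ × ι × ι => ∑ a, ∑ b, C (g v.2.1 a * h b v.2.2) * X (v.1, a, b)) (n := 1)
      fun v => IsHomogeneous.sum _ _ _ fun a _ => IsHomogeneous.sum _ _ _ fun b _ =>
        (isHomogeneous_X _ _).C_mul _
    rwa [one_mul] at this
  conv_lhs => rw [← sum_homogeneousComponent p]
  rw [map_sum, map_sum]
  by_cases hm : m ∈ Finset.range (p.totalDegree + 1)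
  · rw [Finset.sum_eq_single m]
    · rw [homogeneousComponent_of_mem (hhom m), if_pos rfl]
    · intro j _ hj
      rw [homogeneousComponent_of_mem (hhom j), if_neg (Ne.symm hj)]
    · exact fun h => (h hm).elim
  · rw [homogeneousComponent_eq_zero m p (by simpa using hm), map_zero]
    refine Finset.sum_eq_zero fun j hj => ?_
    rw [homogeneousComponent_of_mem (hhom j), if_neg fun h : m = j => hm (h ▸ hj)]

omit [Fintype κ] in
theorem IsGenericEquivariant.homogeneousComponent
    {H : Matrix (Fin n → ι) (Fin n → ι) (MvPolynomial (κ × ι × ι) F)}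
    (hH : IsGenericEquivariant H) (m : ℕ) :
    IsGenericEquivariant (H.map (homogeneousComponent m)) := by
  intro g h hgh hhg
  ext1 c d
  have := congrArg (MvPolynomial.homogeneousComponent m) (hH.apply hgh hhg c d)
  simpa only [map_sum, mul_comm _ (C _), homogeneousComponent_C_mul, homogeneousComponent_conjSubst,
    Matrix.mul_apply, Matrix.map_apply] using this

variable [CharZero F]

omit [Fintype κ] in
theorem IsGenericEquivariant.mem_of_isHomogeneous_zero
    {H : Matrix (Fin n → ι) (Fin n → ι) (MvPolynomial (κ × ι × ι) F)}
    (hH : IsGenericEquivariant H) (h0 : ∀ c d, (H c d).IsHomogeneous 0) :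
    H ∈ tensorMonomialSpan F κ ι n := by
  obtain ⟨A, rfl⟩ : ∃ A : Matrix (Fin n → ι) (Fin n → ι) F, H = A.map C :=
    ⟨H.map (coeff 0), by
      ext1 c d
      exact totalDegree_eq_zero_iff_eq_C.1 ((h0 c d).totalDegree_le.antisymm (Nat.zero_le _))⟩
  have hmem : A ∈ permSpan ι F n := by
    refine mem_permSpan_of_commute_tensorPow fun g h hgh hhg => ?_
    have hA : (A.map C).map (conjSubst g h) = A.map (C (σ := κ × ι × ι)) := by
      ext1 c d
      exact (conjSubst g h).commutes (A c d)
    have := hH g h hgh hhg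
    rw [hA, ← Matrix.map_mul, ← Matrix.map_mul] at this
    exact Matrix.map_injective (C_injective _ _) this
  let L : Matrix (Fin n → ι) (Fin n → ι) F →ₗ[F]
      Matrix (Fin n → ι) (Fin n → ι) (MvPolynomial (κ × ι × ι) F) :=
    (Algebra.linearMap F (MvPolynomial (κ × ι × ι) F)).mapMatrix
  refine (Submodule.map_span_le L _ _).2 ?_ (Submodule.mem_map_of_mem hmem)
  rintro _ ⟨σ, rfl⟩
  refine Submodule.subset_span ⟨[], fun _ => 1, σ, ?_⟩
  ext1 c d
  have h1 : c ∘ σ = d ↔ ∀ i, c (σ i) = d i := funext_iff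
  simp [L, tensorMonomial, Matrix.one_apply, Fintype.prod_ite_zero, h1, apply_ite]

/-- `n` is quantified inside the induction because lowering the degree by one raises the number of
tensor factors by one. -/
theorem IsGenericEquivariant.mem_of_isHomogeneous (m : ℕ) :
    ∀ {n : ℕ} {H : Matrix (Fin n → ι) (Fin n → ι) (MvPolynomial (κ × ι × ι) F)},
      IsGenericEquivariant H → (∀ c d, (H c d).IsHomogeneous m) →
      H ∈ tensorMonomialSpan F κ ι n := by
  induction m with
  | zero => exact fun hH h => hH.mem_of_isHomogeneous_zero h
  | succ m ih =>
    intro n H hH hm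
    have h1 : ((m + 1 : ℕ) : F) • H ∈ tensorMonomialSpan F κ ι n := by
      rw [Nat.cast_smul_eq_nsmul, ← sum_contract_matrixDeriv H hm]
      exact Submodule.sum_mem _ fun i _ => contract_mem i
        (ih (hH.matrixDeriv i) fun c d => (hm _ _).pderiv)
    exact (Submodule.smul_mem_iff _ (Nat.cast_ne_zero.2 m.succ_ne_zero)).1 h1

theorem IsGenericEquivariant.mem_tensorMonomialSpan
    {H : Matrix (Fin n → ι) (Fin n → ι) (MvPolynomial (κ × ι × ι) F)}
    (hH : IsGenericEquivariant H) : H ∈ tensorMonomialSpan F κ ι n := by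
  -- A common degree bound lets one sum of components serve all entries.
  let D := Finset.univ.sup fun q : (Fin n → ι) × (Fin n → ι) => (H q.1 q.2).totalDegree
  have hsum : H = ∑ m ∈ Finset.range (D + 1), H.map (MvPolynomial.homogeneousComponent m) := by
    ext1 c d
    rw [Matrix.sum_apply]
    conv_lhs => rw [← sum_homogeneousComponent (H c d)]
    refine Finset.sum_subset (Finset.range_mono ?_) fun m _ hm => ?_
    · exact Nat.succ_le_succ (Finset.le_sup
        (f := fun q : (Fin n → ι) × (Fin n → ι) => (H q.1 q.2).totalDegree)
        (Finset.mem_univ (c, d)))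
    · exact homogeneousComponent_eq_zero _ _ (by simpa using hm)
  rw [hsum]
  exact Submodule.sum_mem _ fun m _ => (hH.homogeneousComponent m).mem_of_isHomogeneous m
    fun c d => homogeneousComponent_isHomogeneous m (H c d)

end Generic

/-! ### Passage between endomorphisms and generic matrices. -/

section Coordinates

variable {F : Type*} [Field F] {V : Type*} [AddCommGroup V] [Module F V] {κ ι : Type*}
  [Fintype ι] [DecidableEq ι] {n : ℕ} (b : Module.Basis ι F V)

/-- The evaluation of polynomials in the entries of generic matrices at the matrices of
endomorphisms `x`. -/
def evalEntries (x : κ → Module.End F V) : MvPolynomial (κ × ι × ι) F →ₐ[F] F :=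
  MvPolynomial.aeval fun v => LinearMap.toMatrix b b (x v.1) v.2.1 v.2.2

theorem exists_eq_evalEntries {f : (κ → Module.End F V) → F} (hf : f ∈ polyFun F V κ) :
    ∃ p : MvPolynomial (κ × ι × ι) F, ∀ x, f x = evalEntries b x p := by
  induction hf using Algebra.adjoin_induction with
  | mem f hf =>
    obtain ⟨i, φ, rfl⟩ := hf
    refine ⟨∑ a, ∑ c, MvPolynomial.C (φ (Matrix.toLin b b (Matrix.single a c 1))) *
      MvPolynomial.X (i, a, c), fun x => ?_⟩
    have h : x i = ∑ a, ∑ c, LinearMap.toMatrix b b (x i) a c •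
        Matrix.toLin b b (Matrix.single a c 1) := by
      conv_lhs => rw [← Matrix.toLin_toMatrix b b (x i),
        Matrix.matrix_eq_sum_single (LinearMap.toMatrix b b (x i))]
      simp only [map_sum, ← map_smul, Matrix.smul_single, smul_eq_mul, mul_one]
    change φ (x i) = _
    rw [h]
    simp [evalEntries, mul_comm]
  | algebraMap r => exact ⟨MvPolynomial.C r, fun x => by simp [evalEntries, MvPolynomial.algHom_C]⟩
  | add f g _ _ hf hg =>
    obtain ⟨p, hp⟩ := hf
    obtain ⟨q, hq⟩ := hg
    exact ⟨p + q, fun x => by rw [map_add, ← hp, ← hq, Pi.add_apply]⟩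
  | mul f g _ _ hf hg =>
    obtain ⟨p, hp⟩ := hf
    obtain ⟨q, hq⟩ := hg
    exact ⟨p * q, fun x => by rw [map_mul, ← hp, ← hq, Pi.mul_apply]⟩

variable (n) in
/-- The basis of `V^{⊗n}` given by a basis of `V`. -/
abbrev tensorBasis : Module.Basis (Fin n → ι) F (TPow F V n) :=
  Basis.piTensorProduct fun _ => b

theorem toMatrix_permOp_mul_map (σ : Equiv.Perm (Fin n)) (f : Fin n → Module.End F V) (c d) :
    LinearMap.toMatrix (tensorBasis n b) (tensorBasis n b)
      (permOp F V n σ * PiTensorProduct.map f) c d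
      = ∏ i, LinearMap.toMatrix b b (f i) (c (σ i)) (d i) := by
  rw [LinearMap.toMatrix_apply, Module.End.mul_apply, Basis.piTensorProduct_apply,
    PiTensorProduct.map_tprod, permOp_tprod, Basis.piTensorProduct_repr_tprod_apply,
    ← Equiv.prod_comp σ]
  simp [LinearMap.toMatrix_apply]

theorem toMatrix_map (f : Module.End F V) :
    LinearMap.toMatrix (tensorBasis n b) (tensorBasis n b) (PiTensorProduct.map fun _ => f)
      = tensorPow n (LinearMap.toMatrix b b f) := by
  ext c d
  have := toMatrix_permOp_mul_map b 1 (fun _ => f) c d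
  rwa [map_one, one_mul] at this

theorem map_genericMonomial (x : κ → Module.End F V) (M : FreeMonoid κ) :
    (genericMonomial F ι M).map (evalEntries b x) = LinearMap.toMatrix b b (evalMonomial M x) := by
  induction M using FreeMonoid.inductionOn' with
  | one =>
    rw [evalMonomial, map_one, map_one, Matrix.map_one _ (map_zero _) (map_one _)]
    exact (LinearMap.toMatrix_one b).symm
  | of_mul i M ih =>
    rw [evalMonomial, map_mul, map_mul, Matrix.map_mul, LinearMap.toMatrix_mul, ih]
    congr 1
    ext a c
    simp [genericMatrix, evalEntries]

/-- The inverse appears because `monomialMap` lets `σ⁻¹` act, whereas `tensorMonomial` uses `σ`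
itself. -/
theorem map_tensorMonomial (x : κ → Module.End F V) (N : List (FreeMonoid κ))
    (M : Fin n → FreeMonoid κ) (σ : Equiv.Perm (Fin n)) :
    (tensorMonomial F ι N M σ).map (evalEntries b x)
      = LinearMap.toMatrix (tensorBasis n b) (tensorBasis n b) (monomialMap N M σ⁻¹ x) := by
  have hM : ∀ (M : FreeMonoid κ) (c d : ι), evalEntries b x (genericMonomial F ι M c d)
      = LinearMap.toMatrix b b (evalMonomial M x) c d := fun M c d =>
    congrFun (congrFun (map_genericMonomial b x M) c) d
  have htr : ∀ M : FreeMonoid κ, evalEntries b x (genericMonomial F ι M).trace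
      = LinearMap.trace F V (evalMonomial M x) := by
    intro M
    rw [LinearMap.trace_eq_matrix_trace F b, Matrix.trace, Matrix.trace, map_sum]
    exact Finset.sum_congr rfl fun a _ => hM M a a
  ext c d
  rw [monomialMap, map_smul, Matrix.smul_apply, toMatrix_permOp_mul_map, inv_inv]
  simp [tensorMonomial, hM, map_list_prod, htr, Function.comp_def]

theorem evalEntries_conjSubst (g : V ≃ₗ[F] V) (x : κ → Module.End F V)
    (p : MvPolynomial (κ × ι × ι) F) :
    evalEntries b x (conjSubst (LinearMap.toMatrix b b g.toLinearMap)
      (LinearMap.toMatrix b b g.symm.toLinearMap) p) = evalEntries b (fun i => g.conj (x i)) p := by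
  rw [← AlgHom.comp_apply]
  congr 1
  refine MvPolynomial.algHom_ext fun ⟨i, a, c⟩ => ?_
  have : g.conj (x i) = g.toLinearMap * x i * g.symm.toLinearMap := rfl
  simp only [conjSubst, evalEntries, AlgHom.comp_apply, MvPolynomial.aeval_X, this,
    LinearMap.toMatrix_mul, Matrix.mul_apply, Finset.sum_mul, map_sum, map_mul,
    MvPolynomial.algHom_C]
  rw [Finset.sum_comm]
  refine Finset.sum_congr rfl fun e _ => Finset.sum_congr rfl fun f _ => ?_
  simp
  ring

/-- Over an infinite field a polynomial identity may be checked at points, and every point is the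
family of matrices of some endomorphisms. -/
theorem isGenericEquivariant_of_isEquivariant [Infinite F]
    {H : (κ → Module.End F V) → Module.End F (TPow F V n)} (hH : IsEquivariant H)
    {P : Matrix (Fin n → ι) (Fin n → ι) (MvPolynomial (κ × ι × ι) F)}
    (hP : ∀ x, P.map (evalEntries b x)
      = LinearMap.toMatrix (tensorBasis n b) (tensorBasis n b) (H x)) :
    IsGenericEquivariant P := by
  intro g h hgh hhg
  let G : V ≃ₗ[F] V := LinearEquiv.ofLinearMap (Matrix.toLin b b g) (Matrix.toLin b b h)
    (by rw [← Matrix.toLin_mul, hgh, Matrix.toLin_one])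
    (by rw [← Matrix.toLin_mul, hhg, Matrix.toLin_one])
  have hg : LinearMap.toMatrix b b G.toLinearMap = g := LinearMap.toMatrix_toLin b b g
  have hh : LinearMap.toMatrix b b G.symm.toLinearMap = h := LinearMap.toMatrix_toLin b b h
  ext1 c d
  refine MvPolynomial.funext fun y => ?_
  let x : κ → Module.End F V := fun i => Matrix.toLin b b (Matrix.of fun a c => y (i, a, c))
  have hy : ∀ p : MvPolynomial (κ × ι × ι) F, MvPolynomial.eval y p = evalEntries b x p := by
    intro p
    have : (fun v : κ × ι × ι => LinearMap.toMatrix b b (x v.1) v.2.1 v.2.2) = y := by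
      funext v
      simp only [x, LinearMap.toMatrix_toLin, Matrix.of_apply]
    rw [evalEntries, this]
    exact (RingHom.congr_fun (MvPolynomial.coe_aeval_eq_eval y) p).symm
  rw [hy, hy]
  have key : LinearMap.toMatrix (tensorBasis n b) (tensorBasis n b) (H fun i => G.conj (x i)) *
      tensorPow n g
      = tensorPow n g * LinearMap.toMatrix (tensorBasis n b) (tensorBasis n b) (H x) := by
    have hmap : (PiTensorProduct.congr fun _ : Fin n => G).toLinearMap
        = PiTensorProduct.map fun _ => G.toLinearMap := rfl
    rw [← hg, ← toMatrix_map, ← hmap, ← LinearMap.toMatrix_mul, ← LinearMap.toMatrix_mul, hH]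
    refine congrArg _ (LinearMap.ext fun v => ?_)
    simp only [Module.End.mul_apply, LinearEquiv.conj_apply, LinearMap.comp_apply,
      LinearEquiv.coe_coe, LinearEquiv.symm_apply_apply]
  rw [← hP, ← hP] at key
  have := congrFun (congrFun key c) d
  simpa only [Matrix.mul_apply, Matrix.map_apply, map_sum, map_mul, ← evalEntries_conjSubst, hg, hh,
    MvPolynomial.algHom_C, Algebra.algebraMap_self, RingHom.id_apply] using this

end Coordinates

/-! ### The spanning statement and surjectivity. -/

section Main

variable {F : Type*} [Field F] [CharZero F] {V : Type*} [AddCommGroup V] [Module F V]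
  [FiniteDimensional F V] {κ : Type*} {n : ℕ}

theorem mem_span_monomialMap [Fintype κ] {H : (κ → Module.End F V) → Module.End F (TPow F V n)}
    (hpoly : IsPolyMap H) (hequiv : IsEquivariant H) :
    H ∈ Submodule.span F {K | ∃ (N : List (FreeMonoid κ)) (M : Fin n → FreeMonoid κ)
      (σ : Equiv.Perm (Fin n)), K = monomialMap N M σ} := by
  let b := Module.finBasis F V
  let B := tensorBasis n b
  choose P hP using fun c d => exists_eq_evalEntries b
    (hpoly ((LinearMap.proj d ∘ₗ LinearMap.proj c) ∘ₗ (LinearMap.toMatrix B B).toLinearMap))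
  have hP' : ∀ x, (Matrix.of P).map (evalEntries b x) = LinearMap.toMatrix B B (H x) := by
    intro x
    ext c d
    exact (hP c d x).symm
  have hmem := (isGenericEquivariant_of_isEquivariant b hequiv hP').mem_tensorMonomialSpan
  let Θ : Matrix (Fin n → Fin (Module.finrank F V)) (Fin n → Fin (Module.finrank F V))
      (MvPolynomial (κ × Fin (Module.finrank F V) × Fin (Module.finrank F V)) F) →ₗ[F]
      ((κ → Module.End F V) → Module.End F (TPow F V n)) :=
    LinearMap.pi fun x => (Matrix.toLin B B).toLinearMap ∘ₗ (evalEntries b x).toLinearMap.mapMatrix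
  have hΘ : Θ (Matrix.of P) = H := by
    funext x
    exact (congrArg (Matrix.toLin B B) (hP' x)).trans (Matrix.toLin_toMatrix B B (H x))
  rw [← hΘ]
  refine (Submodule.map_span_le Θ _ _).2 ?_ (Submodule.mem_map_of_mem hmem)
  rintro _ ⟨N, M, σ, rfl⟩
  refine Submodule.subset_span ⟨N, M, σ⁻¹, funext fun x => ?_⟩
  exact (congrArg (Matrix.toLin B B) (map_tensorMonomial b x N M σ)).trans
    (Matrix.toLin_toMatrix B B _)

omit [CharZero F] in
theorem exists_evaluation_eq_monomialMap (N : List (FreeMonoid κ)) (M : Fin n → FreeMonoid κ)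
    (σ : Equiv.Perm (Fin n)) :
    ∃ t : TwistedAlgebra F κ n, (evaluation F V κ n t : (κ → Module.End F V) → _)
      = monomialMap N M σ := by
  let c : TraceRing F κ := (N.map fun w => MvPolynomial.X (w.toList : Cycle κ)).prod
  let a : Fin n → FreeTraceAlgebra F κ := fun i =>
    FreeMonoid.lift (FreeAlgebra.ι (TraceRing F κ)) (M i)
  -- In `monomialMap` the permutation stands to the left of the tensor, while `single` writes it on
  -- the right; a product of two singles avoids permuting the factors.
  refine ⟨SkewMonoidAlgebra.single σ⁻¹ 1 *
    SkewMonoidAlgebra.single 1 (c • TraceTensor.tprod a), funext fun x => ?_⟩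
  have hc : evalTrace x c = (N.map fun w => LinearMap.trace F V (evalMonomial w x)).prod := by
    simp only [c, map_list_prod, List.map_map]
    congr 2
    funext w
    simp only [Function.comp_apply, evalTrace_X, evalMonomial, FreeMonoid.lift_apply]
  have ha : ∀ i, evalFree x (a i) = evalMonomial (M i) x := by
    intro i
    have : ((evalFree x : FreeTraceAlgebra F κ →* Module.End F V)).comp
        (FreeMonoid.lift (FreeAlgebra.ι (TraceRing F κ))) = FreeMonoid.lift x :=
      FreeMonoid.hom_eq fun j => by simp [evalFree_ι]
    exact DFunLike.congr_fun this (M i)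
  change evalTwisted x _ = _
  rw [map_mul, evalTwisted_single, evalTwisted_single, map_one, map_one, one_mul, mul_one,
    evalTensor_smul, evalTensor_tprod, monomialMap, hc, mul_smul_comm]
  simp only [ha]

end Main

end TensorFFT

end

theorem mainTheorem3 {F : Type*} [Field F] [CharZero F] {V : Type*} [AddCommGroup V] [Module F V]
    [FiniteDimensional F V] (k n : ℕ) :
    (∀ H : (Fin k → Module.End F V) → Module.End F (TensorFFT.TPow F V n),
      TensorFFT.IsPolyMap H → TensorFFT.IsEquivariant H →
        H ∈ Submodule.span F
          {K | ∃ (N : List (FreeMonoid (Fin k))) (M : Fin n → FreeMonoid (Fin k))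
            (σ : Equiv.Perm (Fin n)), K = TensorFFT.monomialMap N M σ}) ∧
    Function.Surjective (TensorFFT.evaluation F V (Fin k) n) := by
  refine ⟨fun H => TensorFFT.mem_span_monomialMap, fun H => ?_⟩
  -- The range of a linear map is a subspace, so it suffices to reach the spanning monomial maps.
  let L := (TensorFFT.equivariantMaps F V (Fin k) n).val.toLinearMap ∘ₗ
    (TensorFFT.evaluation F V (Fin k) n).toLinearMap
  have hL : (H : (Fin k → Module.End F V) → Module.End F (TensorFFT.TPow F V n)) ∈
      LinearMap.range L := by
    refine Submodule.span_le.2 ?_ (TensorFFT.mem_span_monomialMap H.2.1 H.2.2)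
    rintro _ ⟨N, M, σ, rfl⟩
    exact TensorFFT.exists_evaluation_eq_monomialMap N M σ
  obtain ⟨t, ht⟩ := hL
  exact ⟨t, Subtype.ext ht⟩
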